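/- Let $R$ be a commutative ring. For a small category $\mathcal C$, an $R\mathcal C$-module is a functor $M:\mathcal C\to R\text{-Mod}$, $\underline R$ denotes the constant functor with value $R$, and the cohomology of $\mathcal C$ with coefficients in $M$ is $H^n(\mathcal C;M)=\mathrm{Ext}^n_{R\mathcal C}(\underline R,M)$, an $R$-module. A functor $J:\mathcal D\to\mathcal C$ induces, by restricting $R\mathcal C$-modules along $J$ (an exact functor sending $\underline R$ to $\underline R$), homomorphisms $J^*:H^n(\mathcal C;M)\to H^n(\mathcal D;J^*M)$, where $J^*M=M\circ J$. Let $X:\Delta^{op}\times\Delta^{op}\to \mathrm{Sets}$ be a bisimplicial set. Its simplex category $\Delta(X)$ has as objects the simplices $\sigma\in X_{p,q}$, $p,q\ge 0$; a morphism from $\tau\in X_{r,s}$ to $\sigma\in X_{p,q}$ is a morphism $g:[r]\times[s]\to[p]\times[q]$ in $\Delta\times\Delta$ with $g^*(\sigma)=\tau$. The simplex category of a simplicial set is defined in the same way with $\Delta$ in place of $\Delta\times\Delta$. The diagonal $\mathrm{diag}\,X$ is the simplicial set with $(\mathrm{diag}\,X)_n=X_{n,n}$. A coefficient system over $R$ on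 a simplicial or bisimplicial set $Y$ is a functor $M:\Delta(Y)\to R\text{-Mod}$, and $H^n(Y;M):=H^n(\Delta(Y);M)$. Let $J:\Delta(\mathrm{diag}\,X)\to\Delta(X)$ be the functor that regards a simplex $\sigma\in X_{n,n}$ of $\mathrm{diag}\,X$ as a simplex of $X$ and sends a morphism $f$ to $f\times f$. Then for every commutative ring $R$, every bisimplicial set $X$, every coefficient system $M$ over $R$ on $X$ and every $n\ge 0$, the homomorphism of $R$-modules $$J^*:H^n(X;M)\to H^n(\mathrm{diag}\,X;J^*M)$$ is an isomorphism. -/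

import Mathlib

open CategoryTheory CategoryTheory.Limits

universe v u

section CategoryCohomology

variable (R : Type u) [CommRing R]

/-- The abelian category of (covariant) `RC`-modules: functors from `C` to `R`-modules. -/
abbrev CatMod (C : Type u) [Category.{v} C] : Type (max u v (u + 1)) :=
  C ⥤ ModuleCat.{u} R

/-- A functor category from a small category to `R`-modules has enough projectives. This is only
needed to know that its Ext-groups are small enough to live in `Type u`. -/
theorem catMod_enoughProjectives (C : Type u) [Category.{v} C] [UnivLE.{v, u}] :
    EnoughProjectives (CatMod R C) where
  presentation F := by
    have : HasColimitsOfSize.{v, v} (ModuleCat.{u} R) :=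
      hasColimitsOfSizeOfUnivLE.{u, u, v, v} (ModuleCat.{u} R)
    have (a b : C) : HasCoproductsOfShape (a ⟶ b) (ModuleCat.{u} R) := inferInstance
    let L (c : C) : ModuleCat.{u} R ⥤ CatMod R C := evaluationLeftAdjoint (ModuleCat.{u} R) c
    let adj (c : C) : L c ⊣ (evaluation C (ModuleCat.{u} R)).obj c := evaluationAdjunctionRight _ c
    let P (c : C) : CatMod R C := (L c).obj (Projective.over (F.obj c))
    let p (c : C) : P c ⟶ F := ((adj c).homEquiv _ _).symm (Projective.π (F.obj c))
    have (c : C) : Projective (P c) := (adj c).map_projective _ inferInstance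
    let q : ∐ P ⟶ F := Sigma.desc p
    suffices hq : ∀ c, Epi (q.app c) from
      ⟨{ p := ∐ P, f := q, epi := (NatTrans.epi_iff_epi_app q).2 hq }⟩
    intro c
    have h : (adj c).unit.app _ ≫ (Sigma.ι P c).app c ≫ q.app c =
        Projective.π (F.obj c) := by
      rw [← NatTrans.comp_app, show Sigma.ι P c ≫ q = p c from Sigma.ι_desc p c]
      have := (adj c).homEquiv_unit (X := Projective.over (F.obj c)) (Y := F) (f := p c)
      simp only [p, Equiv.apply_symm_apply] at this
      exact this.symm
    have : Epi ((adj c).unit.app _ ≫ (Sigma.ι P c).app c ≫ q.app c) := by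
      rw [h]; infer_instance
    have := epi_of_epi ((adj c).unit.app _) ((Sigma.ι P c).app c ≫ q.app c)
    exact epi_of_epi ((Sigma.ι P c).app c) _

instance catMod_hasExt (C : Type u) [Category.{v} C] [UnivLE.{v, u}] :
    HasExt.{u} (CatMod R C) :=
  have := catMod_enoughProjectives R C
  hasExt_of_enoughProjectives.{u} (CatMod R C)

/-- The constant `RC`-module with value `R`. -/
abbrev constMod (C : Type u) [Category.{v} C] : CatMod R C :=
  (Functor.const C).obj (ModuleCat.of R R)

/-- The cohomology `H^n(C; M) = Ext^n_{RC}(R, M)` of a small category `C` with coefficients in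
an `RC`-module `M`. It is an `R`-module. -/
abbrev catCohomology {C : Type u} [Category.{v} C] [UnivLE.{v, u}] (M : CatMod R C) (n : ℕ) :
    Type u :=
  Abelian.Ext.{u} (constMod R C) M n

variable {C D : Type u} [Category.{v} C] [Category.{v} D]

/-- Restriction of modules along a functor `J : D ⥤ C`, sending `M` to `J ⋙ M`. -/
abbrev resMod (J : D ⥤ C) : CatMod R C ⥤ CatMod R D :=
  (Functor.whiskeringLeft D C (ModuleCat.{u} R)).obj J

instance resMod_linear (J : D ⥤ C) : (resMod R J).Linear R where
  map_smul _ _ := rfl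

/-- The homomorphism `J^* : H^n(C; M) → H^n(D; J^*M)` induced by a functor `J : D ⥤ C`: the map
on Ext-groups induced by the exact functor `resMod R J`, which sends the constant module on `C`
to the constant module on `D`. -/
noncomputable def catCohomologyMap [UnivLE.{v, u}] (J : D ⥤ C) (M : CatMod R C) (n : ℕ) :
    catCohomology R M n →ₗ[R] catCohomology R (J ⋙ M) n :=
  (resMod R J).mapExtLinearMap R (constMod R C) M n

end CategoryCohomology

section Bisimplicial

/-- Bisimplicial sets. -/
abbrev BisimplicialSet : Type (u + 1) :=
  SimplexCategoryᵒᵖ × SimplexCategoryᵒᵖ ⥤ Type u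

/-- The diagonal simplicial set, `(diag X)_n = X_{n,n}`. -/
abbrev BisimplicialSet.diagonal (X : BisimplicialSet.{u}) : SSet.{u} :=
  Functor.diag SimplexCategoryᵒᵖ ⋙ X

/-- The simplex category `Δ(X)` of a simplicial set: objects are pairs `([n], σ)` with
`σ ∈ X_n`, and a morphism `([m], τ) ⟶ ([n], σ)` is a map `f : [m] ⟶ [n]` in `Δ` such that
`f^* σ = τ`. (A morphism in the category of elements of `X` goes from `σ` to `f^* σ`, hence the
opposite category.) -/
abbrev SSetSimplices (X : SSet.{u}) : Type u :=
  (Functor.Elements X)ᵒᵖ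

/-- The simplex category `Δ(X)` of a bisimplicial set: objects are the simplices
`σ ∈ X_{p,q}`, and a morphism `τ ⟶ σ` from `τ ∈ X_{r,s}` to `σ ∈ X_{p,q}` is a morphism
`g : [r] × [s] ⟶ [p] × [q]` in `Δ × Δ` such that `g^* σ = τ`. -/
abbrev BisimplicialSet.Simplices (X : BisimplicialSet.{u}) : Type u :=
  (Functor.Elements X)ᵒᵖ

/-- The inclusion of diagonal simplices `J : Δ(diag X) ⥤ Δ(X)`, given by
`([n], σ) ↦ ([n] × [n], σ)` and `f ↦ f × f`. -/
abbrev BisimplicialSet.diagonalInclusion (X : BisimplicialSet.{u}) :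
    SSetSimplices X.diagonal ⥤ X.Simplices :=
  (Functor.Elements.precomp (Functor.diag SimplexCategoryᵒᵖ) X).op

end Bisimplicial

/-!
The theorem is a cohomological form of Quillen's Theorem A, applied to the inclusion
`J : D ⥤ C` with `D = Δ(diag X)` and `C = Δ(X)`.

Both `M ↦ H^n(C; M)` and `M ↦ H^n(D; J^*M)` are cohomological functors of the `RC`-module `M`, so by
dimension shifting (`mapExactFunctor_bijective_of_effaceable`) it is enough that `J^*` is bijective
in degree zero and that every `M` embeds in a module with vanishing higher cohomology on both sides.
In degree zero both sides are the limit of `M`, and they agree because the comma categories `J ↓ c`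
are connected. For the embedding, take the product over all `c` of the modules coinduced from the
values `M c`. The restriction to `D` of a module coinduced from `c` is the pushforward of a constant
module along the projection `J ↓ c ⥤ D`. This projection is a discrete fibration, so its pushforward
is exact, and the adjunction between two exact functors (`subsingleton_of_adjunction`) reduces the
vanishing to that of the higher cohomology of `J ↓ c` with constant coefficients. Products do not
disturb the vanishing (`subsingleton_of_isLimit_fan`).

For `c` a simplex of bidimension `(p, q)`, the category `J ↓ c` does not depend on `X`: its objects
are the pairs of maps `[n] ⟶ [p]`, `[n] ⟶ [q]`, that is, the simplices of `Δ^p × Δ^q`. It is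
contractible, since adding a new initial vertex mapped to `(0, 0)` is a functor `T` with natural
transformations from the identity and from a constant functor to `T`. A natural transformation of
exact functors is compatible with Ext-classes (`mapExactFunctor_naturality`), and therefore such a
category has the cohomology of a point (`isAcyclicMod_of_natTrans`).
-/

/-! ### Ext-groups and exact functors -/

namespace CategoryTheory.Abelian.Ext

universe w w' w'' v' u'

theorem exists_shortExact_projective {𝒜 : Type u} [Category.{v} 𝒜] [Abelian 𝒜]
    [EnoughProjectives 𝒜] (X : 𝒜) :
    ∃ (S : ShortComplex 𝒜) (_ : S.X₃ = X), Projective S.X₂ ∧ S.ShortExact := by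
  refine ⟨ShortComplex.mk (kernel.ι (Projective.π X)) (Projective.π X) (by simp), rfl,
    inferInstance, ?_⟩
  exact { exact := ShortComplex.exact_kernel _ }

variable {𝒜 : Type u} [Category.{v} 𝒜] [Abelian 𝒜] [HasExt.{w} 𝒜]
  {ℬ : Type u'} [Category.{v'} ℬ] [Abelian ℬ] [HasExt.{w'} ℬ]

/-- A natural transformation of exact functors is natural with respect to Ext-classes of every
degree: a class of positive degree is a product of extension classes, for which this is the
naturality of the class of a short exact sequence. -/
theorem mapExactFunctor_naturality [EnoughProjectives 𝒜] {F G : 𝒜 ⥤ ℬ}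
    [F.Additive] [PreservesFiniteLimits F] [PreservesFiniteColimits F]
    [G.Additive] [PreservesFiniteLimits G] [PreservesFiniteColimits G]
    (α : F ⟶ G) {n : ℕ} {X Y : 𝒜} (x : Ext.{w} X Y n) :
    (x.mapExactFunctor F).comp (mk₀ (α.app Y)) (add_zero n) =
      (mk₀ (α.app X)).comp (x.mapExactFunctor G) (zero_add n) := by
  induction n generalizing X with
  | zero =>
    obtain ⟨f, rfl⟩ := (mk₀_bijective X Y).2 x
    simp [mapExactFunctor_mk₀]
  | succ n ih =>
    obtain ⟨S, rfl, _, hS⟩ := exists_shortExact_projective X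
    obtain ⟨y, rfl⟩ := contravariant_sequence_exact₃ hS Y x (eq_zero_of_projective _)
      (add_comm 1 n)
    have hδ : (hS.extClass.mapExactFunctor F).comp (mk₀ (α.app S.X₁)) (add_zero 1) =
        (mk₀ (α.app S.X₃)).comp (hS.extClass.mapExactFunctor G) (zero_add 1) := by
      rw [mapExactFunctor_extClass, mapExactFunctor_extClass]
      exact ShortComplex.ShortExact.extClass_naturality (hS.map_of_exact F) (hS.map_of_exact G)
        (S.mapNatTrans α)
    rw [mapExactFunctor_comp, mapExactFunctor_comp, comp_assoc_of_third_deg_zero, ih,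
      ← comp_assoc_of_second_deg_zero, hδ]
    exact comp_assoc _ _ _ _ _ (by lia)

theorem mapExactFunctor_id [EnoughProjectives 𝒜] {n : ℕ} {X Y : 𝒜} (x : Ext.{w} X Y n) :
    x.mapExactFunctor (𝟭 𝒜) = x := by
  induction n generalizing X with
  | zero =>
    obtain ⟨f, rfl⟩ := (mk₀_bijective X Y).2 x
    exact mapExactFunctor_mk₀ _ _
  | succ n ih =>
    obtain ⟨S, rfl, _, hS⟩ := exists_shortExact_projective X
    obtain ⟨y, rfl⟩ := contravariant_sequence_exact₃ hS Y x (eq_zero_of_projective _)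
      (add_comm 1 n)
    rw [mapExactFunctor_comp, ih, mapExactFunctor_extClass]
    rfl

theorem mapExactFunctor_functor_comp [EnoughProjectives 𝒜] {𝒞 : Type*} [Category* 𝒞] [Abelian 𝒞]
    [HasExt.{w''} 𝒞] (F : 𝒜 ⥤ ℬ) (G : ℬ ⥤ 𝒞)
    [F.Additive] [PreservesFiniteLimits F] [PreservesFiniteColimits F]
    [G.Additive] [PreservesFiniteLimits G] [PreservesFiniteColimits G]
    [PreservesFiniteLimits (F ⋙ G)] [PreservesFiniteColimits (F ⋙ G)]
    {n : ℕ} {X Y : 𝒜} (x : Ext.{w} X Y n) :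
    x.mapExactFunctor (F ⋙ G) = (x.mapExactFunctor F).mapExactFunctor G := by
  induction n generalizing X with
  | zero =>
    obtain ⟨f, rfl⟩ := (mk₀_bijective X Y).2 x
    simp [mapExactFunctor_mk₀]
  | succ n ih =>
    obtain ⟨S, rfl, _, hS⟩ := exists_shortExact_projective X
    obtain ⟨y, rfl⟩ := contravariant_sequence_exact₃ hS Y x (eq_zero_of_projective _)
      (add_comm 1 n)
    have hδ : hS.extClass.mapExactFunctor (F ⋙ G) =
        (hS.extClass.mapExactFunctor F).mapExactFunctor G := by
      rw [mapExactFunctor_extClass, mapExactFunctor_extClass]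
      exact (mapExactFunctor_extClass G (hS.map_of_exact F)).symm
    rw [mapExactFunctor_comp, mapExactFunctor_comp, mapExactFunctor_comp, ih, hδ]

/-- One half of the Ext-adjunction isomorphism for a pair of exact adjoint functors: the map
`Ext^n(X, G Y) → Ext^n(L X, Y)`, given by applying `L` and composing with the counit, is injective,
so the source vanishes with the target. -/
theorem subsingleton_of_adjunction [EnoughProjectives 𝒜] {L : 𝒜 ⥤ ℬ} {G : ℬ ⥤ 𝒜} (adj : L ⊣ G)
    [L.Additive] [PreservesFiniteLimits L] [PreservesFiniteColimits L]
    [G.Additive] [PreservesFiniteLimits G] [PreservesFiniteColimits G]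
    (X : 𝒜) (Y : ℬ) (n : ℕ) (hY : Subsingleton (Ext.{w'} (L.obj X) Y n)) :
    Subsingleton (Ext.{w} X (G.obj Y) n) := by
  refine subsingleton_of_forall_eq 0 fun x ↦ ?_
  have hy : (x.mapExactFunctor L).comp (Y := L.obj (G.obj Y)) (mk₀ (adj.counit.app Y))
      (add_zero n) = (0 : Ext (L.obj X) Y n) := hY.elim _ _
  have hGy : ((x.mapExactFunctor L).mapExactFunctor G).comp (mk₀ (G.map (adj.counit.app Y)))
      (add_zero n) = 0 := by
    have := congrArg (fun y : Ext (L.obj X) Y n ↦ y.mapExactFunctor G) hy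
    simpa only [mapExactFunctor_comp, mapExactFunctor_mk₀, mapExactFunctor_zero] using this
  have h : x.comp (mk₀ (adj.unit.app (G.obj Y))) (add_zero n) =
      (mk₀ (adj.unit.app X)).comp ((x.mapExactFunctor L).mapExactFunctor G) (zero_add n) := by
    have := mapExactFunctor_naturality adj.unit x
    rwa [mapExactFunctor_id, mapExactFunctor_functor_comp] at this
  -- The triangle identity recovers `x` from its adjoint.
  have ht : mk₀ (𝟙 (G.obj Y)) = (mk₀ (adj.unit.app (G.obj Y))).comp
      (mk₀ (G.map (adj.counit.app Y))) (add_zero 0) := by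
    rw [mk₀_comp_mk₀, adj.right_triangle_components]
  rw [← comp_mk₀_id x, ht, ← comp_assoc_of_third_deg_zero, h, comp_assoc_of_third_deg_zero, hGy,
    comp_zero]

/-- In positive degrees, the vanishing of Ext is inherited by products in the second variable. No
exactness of products is needed. -/
theorem subsingleton_of_isLimit_fan [EnoughProjectives 𝒜] {ι : Type*} {Y : 𝒜} {B : ι → 𝒜}
    {p : ∀ i, Y ⟶ B i} (hp : IsLimit (Fan.mk Y p)) (X : 𝒜) (n : ℕ)
    (h : ∀ i, Subsingleton (Ext.{w} X (B i) (n + 1))) :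
    Subsingleton (Ext.{w} X Y (n + 1)) := by
  refine subsingleton_of_forall_eq 0 fun x ↦ ?_
  induction n generalizing X with
  | zero =>
    obtain ⟨S, rfl, _, hS⟩ := exists_shortExact_projective X
    obtain ⟨y, rfl⟩ := contravariant_sequence_exact₃ hS Y x (eq_zero_of_projective _)
      (add_zero 1)
    obtain ⟨f, rfl⟩ := (mk₀_bijective _ _).2 y
    have (i : ι) : ∃ g : S.X₂ ⟶ B i, S.f ≫ g = f ≫ p i := by
      obtain ⟨z, hz⟩ := contravariant_sequence_exact₁ hS (B i) (mk₀ (f ≫ p i)) (add_zero 1)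
        (Subsingleton.elim _ _)
      obtain ⟨g, rfl⟩ := (mk₀_bijective _ _).2 z
      exact ⟨g, (mk₀_bijective _ _).1 (by rw [← hz, mk₀_comp_mk₀])⟩
    choose g hg using this
    have hf : f = S.f ≫ Fan.IsLimit.lift hp g := Fan.IsLimit.hom_ext hp _ _ fun i ↦ by
      rw [Category.assoc, Fan.IsLimit.fac]
      exact (hg i).symm
    rw [hf, ← mk₀_comp_mk₀, hS.extClass_comp_assoc]
  | succ n ih =>
    obtain ⟨S, rfl, _, hS⟩ := exists_shortExact_projective X
    obtain ⟨y, rfl⟩ := contravariant_sequence_exact₃ hS Y x (eq_zero_of_projective _)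
      (show 1 + (n + 1) = n + 1 + 1 by lia)
    rw [ih S.X₁ (fun i ↦ subsingleton_of_forall_eq 0 fun z ↦ ?_) y, comp_zero]
    obtain ⟨t, rfl⟩ := contravariant_sequence_exact₁ hS (B i) z
      (show 1 + (n + 1) = n + 1 + 1 by lia) (Subsingleton.elim _ _)
    rw [eq_zero_of_projective t, comp_zero]

/-- Comparison of two cohomological functors by dimension shifting: an exact functor that is
bijective on morphisms out of `X` is bijective on Ext-classes out of `X`, provided that every
object embeds in one on which the positive Ext-groups vanish before and after applying `F`. -/
theorem mapExactFunctor_bijective_of_effaceable (F : 𝒜 ⥤ ℬ) [F.Additive]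
    [PreservesFiniteLimits F] [PreservesFiniteColimits F] (X : 𝒜)
    (h₀ : ∀ Y, Function.Bijective (F.map : (X ⟶ Y) → (F.obj X ⟶ F.obj Y)))
    (h : ∀ Y : 𝒜, ∃ (I : 𝒜) (i : Y ⟶ I), Mono i ∧
      (∀ n, Subsingleton (Ext.{w} X I (n + 1))) ∧
      ∀ n, Subsingleton (Ext.{w'} (F.obj X) (F.obj I) (n + 1)))
    (Y : 𝒜) (n : ℕ) :
    Function.Bijective (mapExactFunctor F : Ext.{w} X Y n → Ext.{w'} (F.obj X) (F.obj Y) n) := by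
  induction n generalizing Y with
  | zero =>
    rw [mapExactFunctor₀]
    exact homEquiv₀.symm.bijective.comp ((h₀ Y).comp homEquiv₀.bijective)
  | succ n ih =>
    obtain ⟨I, i, _, hI, hFI⟩ := h Y
    let S := ShortComplex.mk i (cokernel.π i) (by simp)
    have hS : S.ShortExact := { exact := ShortComplex.exact_cokernel _ }
    have hFS := hS.map_of_exact F
    have key (y : Ext X S.X₃ n) : (y.comp hS.extClass rfl).mapExactFunctor F =
        (y.mapExactFunctor F).comp hFS.extClass rfl := by
      rw [mapExactFunctor_comp, mapExactFunctor_extClass]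
      rfl
    constructor
    · refine (injective_iff_map_eq_zero (F.mapExtAddHom X Y (n + 1))).2 fun x hx ↦ ?_
      obtain ⟨y, rfl⟩ := covariant_sequence_exact₁ X hS x (Subsingleton.elim _ _) rfl
      replace hx := (key y).symm.trans hx
      obtain ⟨z, hz⟩ := covariant_sequence_exact₃ _ hFS _ rfl hx
      obtain ⟨t, rfl⟩ := (ih I).2 z
      have : t.comp (mk₀ S.g) (add_zero n) = y := (ih _).1 (by
        rw [← hz, mapExactFunctor_comp, mapExactFunctor_mk₀]; rfl)
      rw [← this, comp_assoc_of_second_deg_zero, hS.comp_extClass, comp_zero]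
    · intro x
      obtain ⟨y, rfl⟩ := covariant_sequence_exact₁ _ hFS x ((hFI n).elim _ _) rfl
      obtain ⟨t, rfl⟩ := (ih _).2 y
      exact ⟨_, key t⟩

end CategoryTheory.Abelian.Ext

/-! ### Cohomology of small categories -/

namespace CategoryTheory

variable (R : Type u) [CommRing R] {C D : Type u} [Category.{0} C] [Category.{0} D]

section Pushforward

variable {R} (J : D ⥤ C) (c : C)

/-- The components of a section `s` over equal morphisms `g₁ = g₂` have the same images; this is the
form in which the functoriality of `pushforwardMod` avoids transports between fibres. -/
theorem catMod_map_apply_congr {J : D ⥤ C} {c : C} (B : CatMod R (CostructuredArrow J c))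
    {d : D} (s : ∀ g : J.obj d ⟶ c, B.obj (.mk g)) {g₁ g₂ : J.obj d ⟶ c}
    {X : CostructuredArrow J c} (k₁ : .mk g₁ ⟶ X) (k₂ : .mk g₂ ⟶ X) (h : k₁.left = k₂.left) :
    B.map k₁ (s g₁) = B.map k₂ (s g₂) := by
  obtain rfl : g₁ = g₂ := by
    have h₁ : J.map k₁.left ≫ X.hom = g₁ := CostructuredArrow.w k₁
    have h₂ : J.map k₂.left ≫ X.hom = g₂ := CostructuredArrow.w k₂
    rw [← h₁, ← h₂, h]
  rw [CostructuredArrow.hom_ext k₁ k₂ h]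

/-- A morphism `f` of `D`, viewed as a morphism of `J ↓ c` with target `g`. -/
abbrev CostructuredArrow.precompHom {d d' : D} (f : d ⟶ d') (g : J.obj d' ⟶ c) :
    CostructuredArrow.mk (J.map f ≫ g) ⟶ CostructuredArrow.mk g :=
  CostructuredArrow.homMk f rfl

variable (R) in
/-- The right adjoint of restriction along the projection of a comma category `J ↓ c`: the value
at `d` is the product of the values at the objects `g : J d ⟶ c` lying over `d`. No limit over
morphisms is needed, because the projection is a discrete fibration; hence this functor is exact. -/
def pushforwardMod : CatMod R (CostructuredArrow J c) ⥤ CatMod R D where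
  obj B :=
    { obj d := ModuleCat.of R (∀ g : J.obj d ⟶ c, B.obj (.mk g))
      map {d d'} f := ModuleCat.ofHom
        { toFun s g := B.map (CostructuredArrow.precompHom J c f g) (s (J.map f ≫ g))
          map_add' _ _ := by ext; simp
          map_smul' _ _ := by ext; simp }
      map_id d := by
        ext s g
        refine (catMod_map_apply_congr B s (CostructuredArrow.precompHom J c (𝟙 d) g)
          (𝟙 (CostructuredArrow.mk g)) rfl).trans ?_
        simp
      map_comp f f' := by
        ext s g
        refine (catMod_map_apply_congr B s (CostructuredArrow.precompHom J c (f ≫ f') g)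
          (CostructuredArrow.precompHom J c f (J.map f' ≫ g) ≫
            CostructuredArrow.precompHom J c f' g) rfl).trans ?_
        simp }
  map φ :=
    { app d := ModuleCat.ofHom
        { toFun s g := φ.app _ (s g)
          map_add' _ _ := by ext; simp
          map_smul' _ _ := by ext; simp }
      naturality d d' f := by
        ext s g
        exact (NatTrans.naturality_apply φ _ _) }

/-- Restriction along the projection `J ↓ c ⥤ D` is left adjoint to `pushforwardMod`. -/
def pushforwardModAdjunction :
    resMod R (CostructuredArrow.proj J c) ⊣ pushforwardMod R J c :=
  Adjunction.mkOfUnitCounit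
    { unit :=
        { app A :=
            { app d := ModuleCat.ofHom
                { toFun a _ := a
                  map_add' _ _ := rfl
                  map_smul' _ _ := rfl } } }
      counit :=
        { app B :=
            { app X := ModuleCat.ofHom
                { toFun s := s X.hom
                  map_add' _ _ := rfl
                  map_smul' _ _ := rfl }
              naturality X Y f := by
                ext s
                exact catMod_map_apply_congr B s _ f rfl } } }

instance : (pushforwardMod R J c).Additive where

instance : PreservesFiniteLimits (pushforwardMod R J c) :=
  have := (pushforwardModAdjunction (R := R) J c).rightAdjoint_preservesLimits
  inferInstance

instance : PreservesFiniteColimits (pushforwardMod R J c) := by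
  suffices h : ∀ S : ShortComplex (CatMod R (CostructuredArrow J c)), S.ShortExact →
      (S.map (pushforwardMod R J c)).ShortExact by
    have := ((pushforwardMod R J c).exact_tfae.out 0 3).1 h
    exact this.2
  intro S hS
  have := hS.mono_f
  have := hS.epi_g
  refine
    { exact := hS.exact.map_of_mono_of_preservesKernel _ inferInstance inferInstance
      mono_f := (inferInstance : Mono ((pushforwardMod R J c).map S.f))
      epi_g := ?_ }
  refine (NatTrans.epi_iff_epi_app _).2 fun d ↦ (ModuleCat.epi_iff_surjective _).2 fun s ↦ ?_
  have (g : J.obj d ⟶ c) : Function.Surjective (S.g.app (.mk g)) :=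
    (ModuleCat.epi_iff_surjective _).1 inferInstance
  choose t ht using this
  exact ⟨fun g ↦ t g (s g), funext fun g ↦ ht g (s g)⟩

end Pushforward

/-- A category is acyclic over `R` if its cohomology with constant coefficients vanishes in
positive degrees. -/
def IsAcyclicMod (E : Type u) [Category.{0} E] : Prop :=
  ∀ (V : ModuleCat.{u} R) (n : ℕ),
    Subsingleton (Abelian.Ext (constMod R E) ((Functor.const E).obj V) (n + 1))

/-- Homotopy invariance: a category whose identity functor is connected to a constant functor by
two natural transformations has the cohomology of a point. -/
theorem isAcyclicMod_of_natTrans {E : Type u} [Category.{0} E] (T : E ⥤ E) (e : E)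
    (η : 𝟭 E ⟶ T) (ε : (Functor.const E).obj e ⟶ T) : IsAcyclicMod R E := by
  intro V n
  refine subsingleton_of_forall_eq 0 fun x ↦ ?_
  have := catMod_enoughProjectives R E
  -- Restriction along the constant functor at `e` factors through modules over a point.
  let F : CatMod R E ⥤ CatMod R E := (evaluation E _).obj e ⋙ Functor.const E
  have : (Functor.const E : ModuleCat.{u} R ⥤ _).Additive := { map_add := rfl }
  have : F.Additive := { map_add := rfl }
  let α : 𝟭 (CatMod R E) ⟶ resMod R T :=
    { app A :=
        { app d := A.map (η.app d)
          naturality X Y f := by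
            refine (A.map_comp _ _).symm.trans (.trans ?_ (A.map_comp _ _))
            exact congrArg A.map (η.naturality f) } }
  let β : F ⟶ resMod R T :=
    { app A :=
        { app d := A.map (ε.app d)
          naturality X Y f := by
            refine (Category.id_comp _).trans (.trans ?_ (A.map_comp _ _))
            exact congrArg A.map ((Category.id_comp _).symm.trans (ε.naturality f)) } }
  have hF : x.mapExactFunctor F = 0 := by
    rw [Abelian.Ext.mapExactFunctor_functor_comp]
    have : Projective (((evaluation E (ModuleCat.{u} R)).obj e).obj (constMod R E)) :=
      inferInstanceAs (Projective (ModuleCat.of R R))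
    rw [Abelian.Ext.eq_zero_of_projective (x.mapExactFunctor _),
      Abelian.Ext.mapExactFunctor_zero]
  -- On constant modules both transformations are identities.
  have (V : ModuleCat.{u} R) : IsIso (α.app ((Functor.const E).obj V)) :=
    (inferInstance : IsIso (𝟙 ((Functor.const E).obj V)))
  have (V : ModuleCat.{u} R) : IsIso (β.app ((Functor.const E).obj V)) :=
    (inferInstance : IsIso (𝟙 ((Functor.const E).obj V)))
  have hT : x.mapExactFunctor (resMod R T) = 0 := by
    have h := Abelian.Ext.mapExactFunctor_naturality β x
    rw [hF, Abelian.Ext.zero_comp] at h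
    rw [← Abelian.Ext.mk₀_id_comp (x.mapExactFunctor (resMod R T)),
      ← IsIso.inv_hom_id (β.app (constMod R E)), ← Abelian.Ext.mk₀_comp_mk₀_assoc, ← h,
      Abelian.Ext.comp_zero]
  have h := Abelian.Ext.mapExactFunctor_naturality α x
  rw [hT, Abelian.Ext.comp_zero, Abelian.Ext.mapExactFunctor_id] at h
  rw [← Abelian.Ext.comp_mk₀_id x]
  refine (congrArg (fun k ↦ x.comp (Abelian.Ext.mk₀ k) (add_zero _))
    (IsIso.hom_inv_id (α.app ((Functor.const E).obj V)))).symm.trans ?_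
  rw [← Abelian.Ext.mk₀_comp_mk₀, ← Abelian.Ext.comp_assoc_of_third_deg_zero, h,
    Abelian.Ext.zero_comp]

theorem isConnected_of_natTrans {E : Type u} [Category.{0} E] (T : E ⥤ E) (e : E)
    (η : 𝟭 E ⟶ T) (ε : (Functor.const E).obj e ⟶ T) : IsConnected E := by
  have : Nonempty E := ⟨e⟩
  have h (X : E) : Zigzag X e := (Zigzag.of_hom (η.app X)).trans (Zigzag.of_inv (ε.app X))
  exact zigzag_isConnected fun X Y ↦ (h X).trans (h Y).symm

/-- A slice category is acyclic: it has a terminal object. -/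
theorem isAcyclicMod_costructuredArrow_id (c : C) :
    IsAcyclicMod R (CostructuredArrow (𝟭 C) c) :=
  isAcyclicMod_of_natTrans R ((Functor.const _).obj (.mk (𝟙 c))) (.mk (𝟙 c))
    { app X := CostructuredArrow.homMk X.hom
      naturality X Y f := by
        ext
        simpa using CostructuredArrow.w f } (𝟙 _)

/-- For an initial functor `J`, a map from the constant module to `M` is the same thing before and
after restriction along `J`, since both are elements of the limit of `M`. -/
theorem resMod_map_bijective_of_initial (J : D ⥤ C) [J.Initial] (M : CatMod R C) :
    Function.Bijective ((resMod R J).map :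
      (constMod R C ⟶ M) → ((resMod R J).obj (constMod R C) ⟶ (resMod R J).obj M)) := by
  constructor
  · intro f g h
    ext c : 2
    obtain ⟨X⟩ : Nonempty (CostructuredArrow J c) := inferInstance
    have hX := congrArg (fun k ↦ k.app X.left ≫ M.map X.hom) h
    have key (k : constMod R C ⟶ M) : k.app (J.obj X.left) ≫ M.map X.hom = k.app c :=
      (k.naturality X.hom).symm.trans (Category.id_comp _)
    exact (key f).symm.trans (hX.trans (key g))
  · intro f
    let s : Cone (J ⋙ M) := ⟨ModuleCat.of R R, f⟩
    refine ⟨(Functor.Initial.extendCone.obj s).π, ?_⟩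
    ext d : 2
    exact (Functor.Initial.extendCone_obj_π_app' s (𝟙 (J.obj d))).trans <|
      (congrArg (f.app d ≫ ·) (M.map_id _)).trans (Category.comp_id _)

variable {R}

/-- The map from a module to the module coinduced from its value at `c`, which sends `m` to the
function `g ↦ g_* m`. It is injective at `c`. -/
def toPushforwardConst (M : CatMod R C) (c : C) :
    M ⟶ (pushforwardMod R (𝟭 C) c).obj ((Functor.const _).obj (M.obj c)) where
  app d := ModuleCat.ofHom
    { toFun m g := M.map g m
      map_add' _ _ := by ext; simp
      map_smul' _ _ := by ext; simp }
  naturality d d' f := by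
    ext m
    funext g
    exact (M.map_comp_apply f g m).symm

instance (M : CatMod R C) (c : C) : Mono ((toPushforwardConst M c).app c) :=
  (ModuleCat.mono_iff_injective _).2 fun m m' h ↦ by
    have h : M.map (𝟙 c) m = M.map (𝟙 c) m' := congrFun h (𝟙 c)
    simpa using h

/-- The cohomological form of Quillen's Theorem A: a functor with connected and acyclic comma
categories `J ↓ c` induces isomorphisms on cohomology with arbitrary coefficients. Connectedness is
the assumption that the functor is initial. -/
theorem catCohomologyMap_bijective_of_isAcyclicMod (J : D ⥤ C) [J.Initial]
    (hJ : ∀ c, IsAcyclicMod R (CostructuredArrow J c)) (M : CatMod R C) (n : ℕ) :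
    Function.Bijective (catCohomologyMap R J M n) := by
  have := catMod_enoughProjectives R C
  have := catMod_enoughProjectives R D
  refine Abelian.Ext.mapExactFunctor_bijective_of_effaceable (resMod R J) (constMod R C)
    (resMod_map_bijective_of_initial R J) (fun M ↦ ?_) M n
  -- Every module embeds in a product of coinduced modules.
  let B (c : C) : CatMod R C :=
    (pushforwardMod R (𝟭 C) c).obj ((Functor.const _).obj (M.obj c))
  refine ⟨∏ᶜ B, Pi.lift (toPushforwardConst M), ?_, fun n ↦ ?_, fun n ↦ ?_⟩
  · refine (NatTrans.mono_iff_mono_app _).2 fun c ↦ ?_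
    have h : (Pi.lift (toPushforwardConst M)).app c ≫ (Pi.π B c).app c =
        (toPushforwardConst M c).app c := by
      rw [← NatTrans.comp_app, Pi.lift_π]
    exact mono_of_mono_fac h
  · exact Abelian.Ext.subsingleton_of_isLimit_fan (productIsProduct B) _ n fun c ↦
      Abelian.Ext.subsingleton_of_adjunction (pushforwardModAdjunction (𝟭 C) c) (constMod R C) _ _
        (isAcyclicMod_costructuredArrow_id R c (M.obj c) n)
  · -- The restriction of a coinduced module along `J` is pushed forward from `J ↓ c`.
    have hB (c : C) : (resMod R J).obj (B c) =
        (pushforwardMod R J c).obj ((Functor.const _).obj (M.obj c)) := rfl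
    have hR : (resMod R J).obj (constMod R C) = constMod R D := rfl
    have hfan := isLimitFanMkObjOfIsLimit (resMod R J) B _ (productIsProduct B)
    refine Abelian.Ext.subsingleton_of_isLimit_fan hfan _ n fun c ↦ ?_
    rw [hB, hR]
    exact Abelian.Ext.subsingleton_of_adjunction (pushforwardModAdjunction J c) (constMod R D) _ _
        (hJ c (M.obj c) n)

end CategoryTheory

/-! ### Cones in the simplex category -/

namespace SimplexCategory

open CategoryTheory Simplicial SSet.Augmented.StandardSimplex

theorem δ_zero_comp_shift {n : ℕ} {m : SimplexCategory} (a : ⦋n⦌ ⟶ m) : δ 0 ≫ shift a = a := by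
  ext i : 3
  rfl

theorem const_zero_comp_shift {n : ℕ} {m : SimplexCategory} (a : ⦋n⦌ ⟶ m) :
    const ⦋0⦌ ⦋n + 1⦌ 0 ≫ shift a = const ⦋0⦌ m 0 := by
  ext i : 3
  rfl

theorem shift_comp_shift {n n' : ℕ} {m : SimplexCategory} (f : ⦋n⦌ ⟶ ⦋n'⦌) (a : ⦋n'⦌ ⟶ m) :
    shift (f ≫ δ 0) ≫ shift a = shift (f ≫ a) := by
  ext i : 3
  induction i using Fin.cases <;> rfl

theorem shift_δ_zero (n : ℕ) : shift (δ (0 : Fin (n + 2))) = 𝟙 ⦋n + 1⦌ := by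
  ext i : 3
  induction i using Fin.cases <;> rfl

end SimplexCategory

/-! ### Comma categories of the inclusion of diagonal simplices -/

namespace BisimplicialSet

open SimplexCategory Simplicial SSet.Augmented.StandardSimplex

variable {X : BisimplicialSet.{u}} {c : X.Simplices}

/-- The dimension of the diagonal simplex underlying an object of the comma category. -/
def commaDim (Y : CostructuredArrow X.diagonalInclusion c) : SimplexCategory :=
  Y.left.unop.1.unop

/-- For `c` of bidimension `(p, q)`, the first component `[n] ⟶ [p]` of an object of the comma
category. -/
def commaFst (Y : CostructuredArrow X.diagonalInclusion c) : commaDim Y ⟶ c.unop.1.1.unop :=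
  Y.hom.unop.1.1.unop

/-- For `c` of bidimension `(p, q)`, the second component `[n] ⟶ [q]` of an object of the comma
category. -/
def commaSnd (Y : CostructuredArrow X.diagonalInclusion c) : commaDim Y ⟶ c.unop.1.2.unop :=
  Y.hom.unop.1.2.unop

/-- A pair of maps `[n] ⟶ [p]` and `[n] ⟶ [q]` is an object of the comma category over a simplex
of bidimension `(p, q)`. -/
def commaMk (n : SimplexCategory) (a : n ⟶ c.unop.1.1.unop) (b : n ⟶ c.unop.1.2.unop) :
    CostructuredArrow X.diagonalInclusion c :=
  let g : c.unop.1 ⟶ (Functor.diag SimplexCategoryᵒᵖ).obj (.op n) := (a.op, b.op)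
  let y : SSetSimplices X.diagonal := .op (X.diagonal.elementsMk (.op n) (X.map g c.unop.2))
  let k : c.unop ⟶ (X.diagonalInclusion.obj y).unop := ⟨g, rfl⟩
  CostructuredArrow.mk (S := X.diagonalInclusion) (Y := y) k.op

/-- The map of simplices underlying a morphism of the comma category. -/
def commaHomDim {Y Z : CostructuredArrow X.diagonalInclusion c} (k : Y ⟶ Z) :
    commaDim Y ⟶ commaDim Z :=
  k.left.unop.1.unop

theorem commaHomDim_fst {Y Z : CostructuredArrow X.diagonalInclusion c} (k : Y ⟶ Z) :
    commaHomDim k ≫ commaFst Z = commaFst Y :=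
  congrArg (fun l ↦ l.unop.1.1.unop) (CostructuredArrow.w k)

theorem commaHomDim_snd {Y Z : CostructuredArrow X.diagonalInclusion c} (k : Y ⟶ Z) :
    commaHomDim k ≫ commaSnd Z = commaSnd Y :=
  congrArg (fun l ↦ l.unop.1.2.unop) (CostructuredArrow.w k)

theorem commaHom_ext {Y Z : CostructuredArrow X.diagonalInclusion c} {k l : Y ⟶ Z}
    (h : commaHomDim k = commaHomDim l) : k = l := by
  refine CostructuredArrow.hom_ext _ _ (Quiver.Hom.unop_inj (Subtype.ext ?_))
  exact Quiver.Hom.unop_inj h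

/-- A morphism of the comma category is a map of simplices compatible with both components; the
diagonal simplices involved, being restrictions of `c`, are then automatically compatible. -/
def commaHomMk {Y Z : CostructuredArrow X.diagonalInclusion c} (f : commaDim Y ⟶ commaDim Z)
    (h₁ : f ≫ commaFst Z = commaFst Y) (h₂ : f ≫ commaSnd Z = commaSnd Y) : Y ⟶ Z :=
  have h : Z.hom.unop.1 ≫ (Functor.diag SimplexCategoryᵒᵖ).map f.op = Y.hom.unop.1 :=
    Prod.ext (Quiver.Hom.unop_inj h₁) (Quiver.Hom.unop_inj h₂)
  CostructuredArrow.homMk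
    (Quiver.Hom.op ⟨f.op, by
      have hY : X.map Y.hom.unop.1 c.unop.2 = Y.left.unop.2 := Y.hom.unop.2
      have hZ : X.map Z.hom.unop.1 c.unop.2 = Z.left.unop.2 := Z.hom.unop.2
      rw [← hY, ← hZ, ← h]
      exact (X.map_comp_apply _ _ _).symm⟩)
    (Quiver.Hom.unop_inj (Subtype.ext h))

/-- The cone construction `([n], a, b) ↦ ([n + 1], a', b')`, where `a'` and `b'` extend `a` and `b`
by sending the new initial vertex to `0`. -/
def commaCone : CostructuredArrow X.diagonalInclusion c ⥤
    CostructuredArrow X.diagonalInclusion c where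
  obj Y := commaMk ⦋(commaDim Y).len + 1⦌ (shift (commaFst Y)) (shift (commaSnd Y))
  map {Y Z} k := commaHomMk
    (shift (n := (commaDim Y).len) (Δ := ⦋(commaDim Z).len + 1⦌) (commaHomDim k ≫ δ 0))
    ((shift_comp_shift _ _).trans (congrArg shift (commaHomDim_fst k)))
    ((shift_comp_shift _ _).trans (congrArg shift (commaHomDim_snd k)))
  map_id _ := commaHom_ext (shift_δ_zero _)
  map_comp {_ Z W} k l := commaHom_ext
    (shift_comp_shift (n' := (commaDim Z).len)
      (m := ⦋(commaDim W).len + 1⦌) (commaHomDim k) (commaHomDim l ≫ δ 0)).symm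

/-- The face opposite to the cone point. -/
def toCommaCone : 𝟭 (CostructuredArrow X.diagonalInclusion c) ⟶ commaCone where
  app Y := commaHomMk (δ (n := (commaDim Y).len) 0) (δ_zero_comp_shift _) (δ_zero_comp_shift _)
  naturality _ _ _ := commaHom_ext (δ_zero_comp_shift _).symm

variable (c) in
/-- The cone point: the vertex `(0, 0)`. -/
def commaPoint : CostructuredArrow X.diagonalInclusion c :=
  commaMk ⦋0⦌ (const _ _ 0) (const _ _ 0)

/-- The inclusion of the cone point. -/
def fromCommaPoint : (Functor.const _).obj (commaPoint c) ⟶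
    (commaCone : CostructuredArrow X.diagonalInclusion c ⥤ _) where
  app Y := commaHomMk (const ⦋0⦌ ⦋(commaDim Y).len + 1⦌ 0) (const_zero_comp_shift _)
    (const_zero_comp_shift _)
  naturality _ _ _ := commaHom_ext (const_zero_comp_shift _).symm

instance (X : BisimplicialSet.{u}) : X.diagonalInclusion.Initial where
  out _ := isConnected_of_natTrans commaCone _ toCommaCone fromCommaPoint

end BisimplicialSet

theorem mainTheorem4 (R : Type u) [CommRing R] (X : BisimplicialSet.{u})
    (M : X.Simplices ⥤ ModuleCat.{u} R) (n : ℕ) :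
    Function.Bijective
      (catCohomologyMap R X.diagonalInclusion M n :
        catCohomology R M n →ₗ[R] catCohomology R (X.diagonalInclusion ⋙ M) n) :=
  catCohomologyMap_bijective_of_isAcyclicMod X.diagonalInclusion
    (fun _ ↦ isAcyclicMod_of_natTrans R BisimplicialSet.commaCone _ BisimplicialSet.toCommaCone
      BisimplicialSet.fromCommaPoint) M n
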